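/- Let $G$ be a finitely generated group with a finite generating set $\Sigma$. For $g\in G$ let $|g|_\Sigma$ be the least $n\ge 0$ such that $g$ is a product of $n$ elements of $\Sigma\cup\Sigma^{-1}$, let the length of an orbit of $\operatorname{Aut}(G)$ on $G$ be the minimum of $|h|_\Sigma$ over its elements $h$, and let $\alpha_{G,\Sigma}(n)$ be the number of $\operatorname{Aut}(G)$-orbits on $G$ of length at most $n$. For functions $f,g:\mathbb N\to\mathbb N$ write $f\preccurlyeq g$ if there is an integer $\lambda\ge 1$ with $f(n)\le \lambda\, g(\lambda n+\lambda)+\lambda$ for all $n\in\mathbb N$, and $f\sim g$ if $f\preccurlyeq g$ and $g\preccurlyeq f$. We say that the automorphic growth of $G$ is constant, linear, or quadratic if $G$ is finitely generated and, for every finite generating set $\Sigma$ of $G$, $\alpha_{G,\Sigma}(n)\sim 1$, $\alpha_{G,\Sigma}(n)\sim n$, or $\alpha_{G,\Sigma}(n)\sim n^2$, respectively. **Theorem.** Let $G$ be a group with a finite-index normal subgroup $A\cong\mathbb Z^m$. 1. If $m=0$, then the automorphic growth of $G$ is constant. 2. If $m=1$, then the automorphic growth of $G$ is linear. 3. If $m=2$,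 then the automorphic growth of $G$ is linear or quadratic. In this case it is linear if and only if there is a homomorphism $\operatorname{sgn}\colon G\to\{1,-1\}$ such that $g^{-1}xg=x^{\operatorname{sgn}(g)}$ for all $g\in G$ and all $x\in A$. -/

import Mathlib

namespace AutGrowth

section Length

open scoped Pointwise

variable {G : Type*} [Group G]

/-- The word length `|g|_S`: the least `n` such that `g` is a product of `n` elements of
`S ∪ S⁻¹`. (It is only used for generating sets `S`, for which such an `n` exists.) -/
noncomputable def wordLength (S : Finset G) (g : G) : ℕ :=
  sInf {n : ℕ | g ∈ ((S : Set G) ∪ (S : Set G)⁻¹) ^ n}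

end Length

/-- The set `G / Aut(G)` of orbits of `G` under its full automorphism group. -/
abbrev AutOrbit (G : Type*) [Group G] : Type _ :=
  MulAction.orbitRel.Quotient (MulAut G) G

/-- The length of an automorphic orbit: the least word length of its elements. -/
noncomputable def orbitLength {G : Type*} [Group G] (S : Finset G) (O : AutOrbit G) : ℕ :=
  sInf {k : ℕ | ∃ h ∈ O.orbit, wordLength S h = k}

/-- The (cumulative) automorphic growth function `α_{G,S}`: the number of automorphic orbits
of length at most `n`. -/
noncomputable def autGrowth {G : Type*} [Group G] (S : Finset G) (n : ℕ) : ℕ :=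
  {O : AutOrbit G | orbitLength S O ≤ n}.ncard

/-- The growth preorder `f ≼ g`. -/
def GrowthLE (f g : ℕ → ℕ) : Prop :=
  ∃ c : ℕ, c ≠ 0 ∧ ∀ n : ℕ, f n ≤ c * g (c * n + c) + c

/-- Equivalence `f ∼ g` of growth functions. -/
def GrowthEquiv (f g : ℕ → ℕ) : Prop :=
  GrowthLE f g ∧ GrowthLE g f

/-- `α_G = [f]`: the group `G` is finitely generated, and its automorphic growth function with
respect to every finite generating set is equivalent to `f`. -/
def HasAutGrowth (G : Type*) [Group G] (f : ℕ → ℕ) : Prop :=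
  Group.FG G ∧
    ∀ S : Finset G, Subgroup.closure (S : Set G) = ⊤ → GrowthEquiv (autGrowth S) f

/-- `α_G` is constant. -/
def HasConstantAutGrowth (G : Type*) [Group G] : Prop :=
  HasAutGrowth G (fun _ => 1)

/-- `α_G` is linear. -/
def HasLinearAutGrowth (G : Type*) [Group G] : Prop :=
  HasAutGrowth G (fun n => n)

/-- `α_G` is quadratic. -/
def HasQuadraticAutGrowth (G : Type*) [Group G] : Prop :=
  HasAutGrowth G (fun n => n ^ 2)

end AutGrowth

/-!
Write `k` for the index of `A` and identify `A` with `V = ℤ ^ m`, on which `G` acts by conjugation;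
this action depends only on the coset modulo `A`, since `A` is abelian.

*Coordinates.* The transfer with twisted coefficients is a crossed homomorphism `τ : G → V` with
`τ(a) = k a` for `a ∈ A` (`transfer_mul`, `transfer_coe`). An element `g` is determined by its coset
`gA` and by `τ(g)`, and `τ` is Lipschitz for the word length (`exists_abs_transfer_le`). Hence the
ball of radius `n` has `O((n + 1) ^ m)` elements, which bounds the automorphic growth from above.

*Linear lower bound.* Automorphisms need not preserve `A`, but they map `k`-th powers of elements of
`A` into `A`, which yields a linear map `T_φ : V → V`, `v ↦ φ(v)^k`, with `T_{φ⁻¹} T_φ = k²`. So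
divisibility is preserved up to `k`, and for a basis vector `v` the elements `k(1 + ks)v` lie in
pairwise different orbits (`growthLE_autGrowth_of_pos`).

*Rank two, scalar action.* If `N` is an endomorphism of `V` commuting with the action of `G`, then
`g ↦ N(τ(g)) g` is an endomorphism of `G` that fixes the cosets of `A` and acts on `τ` through
`1 + kN`. If `G` acts by scalars, `N` is arbitrary, so the principal congruence subgroup of level
`k` in `SL₂(ℤ)` acts on `G` by automorphisms. As `τ(g) = γ(d, 0)` with `γ ∈ SL₂(ℤ)`, the orbit of
`g` depends only on `gA`, `d` and `γ` modulo `k` (`toOrbit_eq_of_scalar`), and the growth is linear.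

*Rank two, nonscalar action.* Let `g` act by a nonscalar matrix `P`; it satisfies `P ^ k = 1`. If
`φ(g)` and `ψ(g)` lie in the same coset, then `adj(T_φ) T_ψ` commutes with `P` and has bounded
determinant. There are only finitely many such integral matrices: their traces are bounded
(`abs_trace_le`) and determine them (`eq_of_trace_eq`), because `P` is elliptic or a reflection
(`elliptic_or_reflection`). So the orbits of `k`-th powers of elements of `A` contain boundedly many
such elements, and the growth is at least quadratic (`sq_growthLE_autGrowth`).
-/

namespace AutGrowth

/-! ### Word length -/

section WordLength

open scoped Pointwise

variable {G : Type*} [Group G] {S : Finset G}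

/-- The symmetrised generating set `S ∪ S⁻¹`. -/
abbrev letters (S : Finset G) : Set G := (S : Set G) ∪ (S : Set G)⁻¹

theorem finite_letters (S : Finset G) : (letters S).Finite :=
  S.finite_toSet.union S.finite_toSet.inv

theorem exists_mem_letters_pow (hS : Subgroup.closure (S : Set G) = ⊤) (g : G) :
    ∃ n, g ∈ letters S ^ n := by
  have hg : g ∈ Subgroup.closure (S : Set G) := hS ▸ Subgroup.mem_top g
  induction hg using Subgroup.closure_induction with
  | mem x hx => exact ⟨1, by rw [pow_one]; exact Or.inl hx⟩
  | one => exact ⟨0, by simp⟩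
  | mul x y _ _ hx hy =>
    obtain ⟨a, ha⟩ := hx
    obtain ⟨b, hb⟩ := hy
    exact ⟨a + b, by rw [pow_add]; exact Set.mul_mem_mul ha hb⟩
  | inv x _ hx =>
    obtain ⟨a, ha⟩ := hx
    have hsymm : (letters S)⁻¹ = letters S := by
      rw [letters, Set.union_inv, inv_inv, Set.union_comm]
    exact ⟨a, by rw [← hsymm, inv_pow]; exact Set.inv_mem_inv.2 ha⟩

theorem mem_letters_pow_wordLength (hS : Subgroup.closure (S : Set G) = ⊤) (g : G) :
    g ∈ letters S ^ wordLength S g :=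
  Nat.sInf_mem (s := {n | g ∈ letters S ^ n}) (exists_mem_letters_pow hS g)

theorem wordLength_le_of_mem {g : G} {n : ℕ} (h : g ∈ letters S ^ n) : wordLength S g ≤ n :=
  Nat.sInf_le (s := {n | g ∈ letters S ^ n}) h

theorem wordLength_one : wordLength S (1 : G) = 0 :=
  Nat.le_zero.1 (wordLength_le_of_mem (by simp))

theorem wordLength_mul_le (hS : Subgroup.closure (S : Set G) = ⊤) (g h : G) :
    wordLength S (g * h) ≤ wordLength S g + wordLength S h :=
  wordLength_le_of_mem (by
    rw [pow_add]
    exact Set.mul_mem_mul (mem_letters_pow_wordLength hS g) (mem_letters_pow_wordLength hS h))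

theorem wordLength_pow_le (hS : Subgroup.closure (S : Set G) = ⊤) (g : G) (n : ℕ) :
    wordLength S (g ^ n) ≤ n * wordLength S g := by
  induction n with
  | zero => simp [wordLength_one]
  | succ n ih =>
    rw [pow_succ, Nat.succ_mul]
    exact (wordLength_mul_le hS _ _).trans (Nat.add_le_add_right ih _)

theorem finite_wordLength_le (hS : Subgroup.closure (S : Set G) = ⊤) (n : ℕ) :
    {g : G | wordLength S g ≤ n}.Finite := by
  have hfin : (⋃ k ∈ Set.Iic n, letters S ^ k).Finite := by
    refine (Set.finite_Iic n).biUnion fun k _ => ?_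
    clear * -
    induction k with
    | zero => simp
    | succ k ih => rw [pow_succ]; exact Set.Finite.mul ih (finite_letters S)
  refine hfin.subset fun g hg => ?_
  simp only [Set.mem_iUnion]
  exact ⟨_, hg, mem_letters_pow_wordLength hS g⟩

/-- A function on `G` that grows by at most `K` under right multiplication by a letter grows at
most linearly in the word length. -/
theorem le_mul_wordLength (hS : Subgroup.closure (S : Set G) = ⊤) {f : G → ℤ} {K : ℕ}
    (h1 : f 1 ≤ 0) (hf : ∀ g, ∀ u ∈ letters S, f (g * u) ≤ f g + K) (g : G) :
    f g ≤ K * wordLength S g := by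
  have key : ∀ n : ℕ, ∀ g ∈ letters S ^ n, f g ≤ K * n := by
    intro n
    induction n with
    | zero =>
      intro g hg
      rw [pow_zero, Set.mem_one] at hg
      simpa [hg] using h1
    | succ n ih =>
      intro g hg
      rw [pow_succ] at hg
      obtain ⟨x, hx, u, hu, rfl⟩ := Set.mem_mul.1 hg
      have := hf x u hu
      have := ih x hx
      push_cast
      linarith
  exact key _ g (mem_letters_pow_wordLength hS g)

end WordLength

/-! ### Counting automorphic orbits -/

section Counting

variable {G : Type*} [Group G] {S : Finset G}

/-- The automorphic orbit of an element. -/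
abbrev toOrbit (g : G) : AutOrbit G := Quotient.mk _ g

theorem toOrbit_eq_iff {g h : G} : toOrbit g = toOrbit h ↔ ∃ φ : MulAut G, φ h = g :=
  Quotient.eq.trans (MulAction.orbitRel_apply.trans Iff.rfl)

theorem setOf_orbitLength_le (n : ℕ) :
    {O : AutOrbit G | orbitLength S O ≤ n} = toOrbit '' {g : G | wordLength S g ≤ n} := by
  ext O
  constructor
  · intro hO
    have hne : {k : ℕ | ∃ h ∈ O.orbit, wordLength S h = k}.Nonempty :=
      ⟨_, O.out, MulAction.orbitRel.Quotient.mem_orbit.2 (Quotient.out_eq' O), rfl⟩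
    obtain ⟨h, hh, hk⟩ := Nat.sInf_mem hne
    refine ⟨h, ?_, MulAction.orbitRel.Quotient.mem_orbit.1 hh⟩
    exact hk.le.trans hO
  · rintro ⟨g, hg, rfl⟩
    have hmem : g ∈ (toOrbit g).orbit := MulAction.orbitRel.Quotient.mem_orbit.2 rfl
    refine (Nat.sInf_le ?_).trans hg
    exact ⟨g, hmem, rfl⟩

theorem finite_orbitLength_le (hS : Subgroup.closure (S : Set G) = ⊤) (n : ℕ) :
    {O : AutOrbit G | orbitLength S O ≤ n}.Finite := by
  rw [setOf_orbitLength_le]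
  exact (finite_wordLength_le hS n).image _

theorem autGrowth_mono (hS : Subgroup.closure (S : Set G) = ⊤) : Monotone (autGrowth S) :=
  fun _ n h => Set.ncard_le_ncard (fun _ hO => le_trans hO h) (finite_orbitLength_le hS n)

/-- Upper bound: a function `inv` on `G` that separates automorphic orbits and maps the ball of
radius `n` into a finite set `t` gives at most `#t` orbits of length at most `n`. -/
theorem autGrowth_le_card {I : Type*} (inv : G → I) (t : Finset I) (n : ℕ)
    (hinv : ∀ g h : G, inv g = inv h → toOrbit g = toOrbit h)
    (ht : ∀ g : G, wordLength S g ≤ n → inv g ∈ t) : autGrowth S n ≤ t.card := by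
  rw [autGrowth, ← Set.ncard_coe_finset]
  have hex : ∀ O : AutOrbit G, orbitLength S O ≤ n → ∃ g, toOrbit g = O ∧ wordLength S g ≤ n := by
    intro O hO
    have : O ∈ toOrbit '' {g : G | wordLength S g ≤ n} := by
      rw [← setOf_orbitLength_le]; exact hO
    obtain ⟨g, hg, rfl⟩ := this
    exact ⟨g, rfl, hg⟩
  choose! r hr using hex
  refine Set.ncard_le_ncard_of_injOn (fun O => inv (r O)) (fun O hO => ht _ (hr O hO).2) ?_
    t.finite_toSet
  intro O hO O' hO' h
  rw [← (hr O hO).1, ← (hr O' hO').1]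
  exact hinv _ _ h

/-- Lower bound: a finite family of elements of length at most `n`, at most `L` of which lie in
any one orbit, gives at least `#s / L` orbits of length at most `n`. -/
theorem card_le_mul_autGrowth (hS : Subgroup.closure (S : Set G) = ⊤) {ι : Type*} (s : Finset ι)
    (x : ι → G) (n L : ℕ) (hx : ∀ i ∈ s, wordLength S (x i) ≤ n)
    (hL : ∀ i ∈ s, ∀ t ⊆ s, (∀ j ∈ t, toOrbit (x j) = toOrbit (x i)) → t.card ≤ L) :
    s.card ≤ L * autGrowth S n := by
  classical
  have h1 : s.card ≤ L * (s.image fun i => toOrbit (x i)).card := by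
    refine Finset.card_le_mul_card_image s L fun O hO => ?_
    obtain ⟨i, hi, rfl⟩ := Finset.mem_image.1 hO
    exact hL i hi _ (Finset.filter_subset _ _) fun j hj => (Finset.mem_filter.1 hj).2
  refine h1.trans (Nat.mul_le_mul_left _ ?_)
  rw [autGrowth, ← Set.ncard_coe_finset]
  refine Set.ncard_le_ncard ?_ (finite_orbitLength_le hS n)
  intro O hO
  obtain ⟨i, hi, rfl⟩ := Finset.mem_image.1 (Finset.mem_coe.1 hO)
  rw [setOf_orbitLength_le]
  exact ⟨_, hx i hi, rfl⟩

end Counting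

/-! ### The growth preorder -/

theorem GrowthLE.trans {f g h : ℕ → ℕ} (hh : Monotone h) (hfg : GrowthLE f g)
    (hgh : GrowthLE g h) : GrowthLE f h := by
  obtain ⟨a, ha, hfg⟩ := hfg
  obtain ⟨b, hb, hgh⟩ := hgh
  refine ⟨a * b + a + b, by positivity, fun n => (hfg n).trans ?_⟩
  have h1 := hgh (a * n + a)
  have h2 : h (b * (a * n + a) + b) ≤ h ((a * b + a + b) * n + (a * b + a + b)) :=
    hh (by nlinarith [Nat.zero_le (a * n), Nat.zero_le (b * n)])
  calc a * g (a * n + a) + a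
      ≤ a * (b * h (b * (a * n + a) + b) + b) + a := by gcongr
    _ ≤ a * (b * h ((a * b + a + b) * n + (a * b + a + b)) + b) + a := by gcongr
    _ ≤ _ := by nlinarith [Nat.zero_le (a * h ((a * b + a + b) * n + (a * b + a + b))),
        Nat.zero_le (b * h ((a * b + a + b) * n + (a * b + a + b)))]

theorem GrowthLE.of_le_mul_pow {f : ℕ → ℕ} {C d : ℕ} (h : ∀ n, f n ≤ C * (n + 1) ^ d) :
    GrowthLE f (fun n => n ^ d) := by
  refine ⟨C + 1, by omega, fun n => (h n).trans ?_⟩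
  have : (n + 1) ^ d ≤ ((C + 1) * n + (C + 1)) ^ d := Nat.pow_le_pow_left (by nlinarith) d
  calc C * (n + 1) ^ d ≤ (C + 1) * ((C + 1) * n + (C + 1)) ^ d := Nat.mul_le_mul (by omega) this
    _ ≤ _ := Nat.le_add_right _ _

theorem GrowthLE.of_le_mul {f g : ℕ → ℕ} (hg : Monotone g) {L C : ℕ}
    (h : ∀ n, f n ≤ L * g (C * (n + 1))) : GrowthLE f g := by
  refine ⟨L + C + 1, by omega, fun n => (h n).trans ?_⟩
  have : g (C * (n + 1)) ≤ g ((L + C + 1) * n + (L + C + 1)) := hg (by nlinarith)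
  calc L * g (C * (n + 1)) ≤ (L + C + 1) * g ((L + C + 1) * n + (L + C + 1)) :=
        Nat.mul_le_mul (by omega) this
    _ ≤ _ := Nat.le_add_right _ _

theorem not_growthLE_sq_id : ¬ GrowthLE (fun n => n ^ 2) (fun n => n) := by
  rintro ⟨c, hc, h⟩
  have := h (2 * c ^ 2 + c + 1)
  have hc' : 1 ≤ c := Nat.one_le_iff_ne_zero.2 hc
  simp only at this
  nlinarith [Nat.zero_le (c ^ 2), Nat.zero_le (c ^ 3)]

/-! ### The conjugation representation and the twisted transfer -/

section Transfer

variable {G V : Type*} [Group G] [AddCommGroup V] {A : Subgroup G}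
  (e : A ≃* Multiplicative V)

/-- The additive coordinate of an element of `A ≅ V`. -/
def coord (a : A) : V := (e a).toAdd

/-- The element of `A` with a given coordinate. -/
def incl (v : V) : A := e.symm (Multiplicative.ofAdd v)

@[simp] theorem coord_incl (v : V) : coord e (incl e v) = v := by simp [coord, incl]

@[simp] theorem incl_coord (a : A) : incl e (coord e a) = a := by simp [coord, incl]

theorem coord_mul (a b : A) : coord e (a * b) = coord e a + coord e b := by simp [coord]

theorem coord_zpow (a : A) (n : ℤ) : coord e (a ^ n) = n • coord e a := by simp [coord]

theorem incl_add (v w : V) : incl e (v + w) = incl e v * incl e w := by simp [incl]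

theorem incl_nsmul (n : ℕ) (v : V) : incl e (n • v) = incl e v ^ n := by simp [incl]

theorem coord_injective : Function.Injective (coord e) :=
  Function.LeftInverse.injective (incl_coord e)

theorem incl_injective : Function.Injective (incl e) :=
  Function.LeftInverse.injective (coord_incl e)

include e in
theorem mul_comm_of_equiv (a b : A) : a * b = b * a :=
  coord_injective e (by rw [coord_mul, coord_mul, add_comm])

variable [hN : A.Normal]

/-- The action `v ↦ g v g⁻¹` of `G` on `V ≅ A`. -/
def conjRep (g : G) : V →ₗ[ℤ] V :=
  (AddMonoidHom.mk' (fun v => coord e (MulAut.conjNormal g (incl e v)))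
    (fun v w => by rw [incl_add, map_mul, coord_mul])).toIntLinearMap

theorem conjRep_coord (g : G) (a : A) :
    conjRep e g (coord e a) = coord e (MulAut.conjNormal g a) := by
  simp [conjRep]

theorem incl_conjRep (g : G) (v : V) :
    (incl e (conjRep e g v) : G) = g * incl e v * g⁻¹ := by
  rw [← MulAut.conjNormal_apply]
  congr 1
  simp [conjRep]

theorem conjRep_mul (g h : G) (v : V) : conjRep e (g * h) v = conjRep e g (conjRep e h v) := by
  apply incl_injective e
  apply Subtype.ext
  simp only [incl_conjRep, mul_inv_rev, mul_assoc]

theorem conjRep_coe (a : A) (v : V) : conjRep e (a : G) v = v := by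
  apply incl_injective e
  apply Subtype.ext
  rw [incl_conjRep, ← Subgroup.coe_mul, mul_comm_of_equiv e, Subgroup.coe_mul,
    mul_inv_cancel_right]

theorem conjRep_one (v : V) : conjRep e (1 : G) v = v := conjRep_coe e 1 v

/-- The conjugation action only depends on the coset modulo the abelian group `A`. -/
theorem conjRep_congr {g h : G} (hgh : (g : G ⧸ A) = h) : conjRep e g = conjRep e h := by
  ext v
  have hmem : g⁻¹ * h ∈ A := QuotientGroup.eq.1 hgh
  have : h = g * ((⟨g⁻¹ * h, hmem⟩ : A) : G) := by simp
  rw [this, conjRep_mul, conjRep_coe]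

/-- The `A`-part `g s(q) s(gq)⁻¹` of the product `g s(q)`, where `s` is the section
`Quotient.out` of `G → G ⧸ A`. -/
noncomputable def cosetPart (A : Subgroup G) [hN : A.Normal] (g : G) (q : G ⧸ A) : A :=
  ⟨g * q.out * ((g : G ⧸ A) * q).out⁻¹, by
    have h : ((g : G ⧸ A) * q) = ((g * q.out : G) : G ⧸ A) := by
      rw [QuotientGroup.mk_mul, QuotientGroup.out_eq']
    rw [← QuotientGroup.eq_one_iff, QuotientGroup.mk_mul, QuotientGroup.mk_inv,
      QuotientGroup.out_eq', ← h, mul_inv_cancel]⟩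

theorem coe_cosetPart (g : G) (q : G ⧸ A) :
    (cosetPart A g q : G) = g * q.out * ((g : G ⧸ A) * q).out⁻¹ := rfl

variable [A.FiniteIndex]

/-- The transfer of `G` into `A` with twisted coefficients: the crossed homomorphism
`τ(g) = ∑ q, g s(q) s(gq)⁻¹`, whose restriction to `A` is multiplication by the index. -/
noncomputable def transfer (g : G) : V :=
  letI := Fintype.ofFinite (G ⧸ A)
  ∑ q : G ⧸ A, coord e (cosetPart A g q)

theorem transfer_mul (g h : G) :
    transfer e (g * h) = transfer e g + conjRep e g (transfer e h) := by
  let := Fintype.ofFinite (G ⧸ A)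
  have key : ∀ q : G ⧸ A, coord e (cosetPart A (g * h) q) =
      coord e (cosetPart A g (h * q)) + conjRep e g (coord e (cosetPart A h q)) := by
    intro q
    rw [conjRep_coord, ← coord_mul, mul_comm_of_equiv e]
    congr 1
    apply Subtype.ext
    rw [Subgroup.coe_mul, MulAut.conjNormal_apply, coe_cosetPart, coe_cosetPart, coe_cosetPart,
      QuotientGroup.mk_mul, mul_assoc (g : G ⧸ A)]
    group
  unfold transfer
  rw [map_sum, ← Equiv.sum_comp (Equiv.mulLeft (h : G ⧸ A)) (fun q => coord e (cosetPart A g q)),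
    ← Finset.sum_add_distrib]
  exact Finset.sum_congr rfl fun q _ => key q

theorem transfer_coe (a : A) : transfer e (a : G) = A.index • coord e a := by
  let := Fintype.ofFinite (G ⧸ A)
  have key : ∀ q : G ⧸ A, cosetPart A (a : G) q = a := by
    intro q
    apply Subtype.ext
    have h1 : ((a : G) : G ⧸ A) = 1 := (QuotientGroup.eq_one_iff _).2 a.2
    rw [coe_cosetPart, h1, one_mul, mul_inv_cancel_right]
  unfold transfer
  simp only [key, Finset.sum_const, Finset.card_univ]
  rw [Subgroup.index, Nat.card_eq_fintype_card]

theorem transfer_one : transfer e (1 : G) = 0 := by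
  have := transfer_coe e 1
  rw [Subgroup.coe_one] at this
  rw [this]
  simp [coord]

/-- An element is determined by its coset and its transfer, as `V` is torsion-free. -/
theorem eq_of_mk_eq_of_transfer_eq [IsAddTorsionFree V] {g h : G} (h1 : (g : G ⧸ A) = h)
    (h2 : transfer e g = transfer e h) : g = h := by
  have hmem : g * h⁻¹ ∈ A := by
    rw [← QuotientGroup.eq_one_iff, QuotientGroup.mk_mul, QuotientGroup.mk_inv, h1,
      mul_inv_cancel]
  have hg : g = ((⟨g * h⁻¹, hmem⟩ : A) : G) * h := by simp
  rw [hg, transfer_mul, conjRep_coe, transfer_coe, add_eq_right,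
    smul_eq_zero_iff_right Subgroup.FiniteIndex.index_ne_zero] at h2
  have : (⟨g * h⁻¹, hmem⟩ : A) = 1 := coord_injective e (by rw [h2]; simp [coord])
  rw [hg, this, Subgroup.coe_one, one_mul]

/-- For an endomorphism `N` of `V` commuting with conjugation, `g ↦ N(τ(g)) g` is an endomorphism
of `G`: crossed homomorphisms into `A` act on `G` by translation. -/
noncomputable def shear (N : V →ₗ[ℤ] V) (hN : ∀ g v, N (conjRep e g v) = conjRep e g (N v)) :
    G →* G :=
  MonoidHom.mk' (fun g => incl e (N (transfer e g)) * g) fun g h => by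
    rw [transfer_mul, map_add, incl_add, hN, Subgroup.coe_mul, incl_conjRep]
    group

variable {e} in
theorem mk_shear {N : V →ₗ[ℤ] V} (hN : ∀ g v, N (conjRep e g v) = conjRep e g (N v)) (g : G) :
    ((shear e N hN g : G) : G ⧸ A) = g := by
  simp only [shear, MonoidHom.mk'_apply, QuotientGroup.mk_mul]
  rw [(QuotientGroup.eq_one_iff _).2 (incl e (N (transfer e g))).2, one_mul]

variable {e} in
theorem transfer_shear {N : V →ₗ[ℤ] V} (hN : ∀ g v, N (conjRep e g v) = conjRep e g (N v))
    (g : G) : transfer e (shear e N hN g) = transfer e g + A.index • N (transfer e g) := by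
  simp only [shear, MonoidHom.mk'_apply]
  rw [transfer_mul, conjRep_coe, transfer_coe, coord_incl, add_comm]

variable {e} in
/-- If `1 + kN` is invertible with inverse `1 + kN'`, where `k` is the index of `A`, the shear by
`N` is an automorphism; so elements of one coset whose transfers correspond under `1 + kN` lie in
the same automorphic orbit. -/
theorem toOrbit_eq_of_transfer [IsAddTorsionFree V] {N N' : V →ₗ[ℤ] V}
    (hN : ∀ g v, N (conjRep e g v) = conjRep e g (N v))
    (hN' : ∀ g v, N' (conjRep e g v) = conjRep e g (N' v))
    (h1 : ∀ v, (v + A.index • N v) + A.index • N' (v + A.index • N v) = v)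
    (h2 : ∀ v, (v + A.index • N' v) + A.index • N (v + A.index • N' v) = v)
    {g h : G} (hgh : (g : G ⧸ A) = h)
    (ht : transfer e g = transfer e h + A.index • N (transfer e h)) :
    toOrbit g = toOrbit h := by
  rw [toOrbit_eq_iff]
  refine ⟨MonoidHom.toMulEquiv (shear e N hN) (shear e N' hN') ?_ ?_, ?_⟩
  · ext x
    refine eq_of_mk_eq_of_transfer_eq e ?_ ?_
    · simp [mk_shear]
    · simp only [MonoidHom.comp_apply, transfer_shear, h1, MonoidHom.id_apply]
  · ext x
    refine eq_of_mk_eq_of_transfer_eq e ?_ ?_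
    · simp [mk_shear]
    · simp only [MonoidHom.comp_apply, transfer_shear, h2, MonoidHom.id_apply]
  · refine eq_of_mk_eq_of_transfer_eq e ?_ ?_
    · rw [hgh]; exact mk_shear hN h
    · rw [ht]; exact transfer_shear hN h

end Transfer

/-! ### Powers of automorphisms on the abelian subgroup -/

section PowMap

variable {G V : Type*} [Group G] [AddCommGroup V] {A : Subgroup G}
  (e : A ≃* Multiplicative V) [hN : A.Normal]

/-- An automorphism `φ` of `G` need not preserve `A`, but `φ(a)^k ∈ A` for the index `k` of `A`;
this is the resulting endomorphism `v ↦ φ(v)^k` of `V ≅ A`. -/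
noncomputable def powMap (φ : MulAut G) : V →ₗ[ℤ] V :=
  (AddMonoidHom.mk' (fun v => coord e ⟨φ (incl e v) ^ A.index, A.pow_index_mem _⟩)
    (fun v w => by
      rw [← coord_mul]
      congr 1
      apply Subtype.ext
      rw [Subgroup.coe_mul]
      have hcomm : Commute (φ (incl e v : G)) (φ (incl e w : G)) := by
        have := congrArg (fun a : A => φ (a : G)) (mul_comm_of_equiv e (incl e v) (incl e w))
        simpa [Commute, SemiconjBy] using this
      rw [← hcomm.mul_pow, ← map_mul, ← Subgroup.coe_mul, ← incl_add])).toIntLinearMap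

theorem incl_powMap (φ : MulAut G) (v : V) :
    (incl e (powMap e φ v) : G) = φ (incl e v) ^ A.index := by
  simp [powMap]

theorem powMap_inv_powMap (φ : MulAut G) (v : V) :
    powMap e φ⁻¹ (powMap e φ v) = (A.index * A.index) • v := by
  apply incl_injective e
  apply Subtype.ext
  rw [incl_powMap, incl_powMap, map_pow, MulAut.inv_apply_self, incl_nsmul, pow_mul,
    Subgroup.coe_pow, Subgroup.coe_pow]

theorem powMap_conjRep (φ : MulAut G) (g : G) (v : V) :
    powMap e φ (conjRep e g v) = conjRep e (φ g) (powMap e φ v) := by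
  apply incl_injective e
  apply Subtype.ext
  rw [incl_powMap, incl_conjRep, incl_conjRep, incl_powMap, map_mul, map_mul, map_inv, conj_pow]

theorem powMap_eq_of_apply_eq {φ : MulAut G} {v w : V}
    (h : φ (incl e (A.index • v)) = incl e w) : powMap e φ v = w := by
  apply incl_injective e
  apply Subtype.ext
  rw [incl_powMap, ← h, incl_nsmul, Subgroup.coe_pow, map_pow]

end PowMap

/-! ### Finite generation and bounds valid for all ranks -/

theorem fg_of_finiteIndex {G : Type*} [Group G] (A : Subgroup G) [A.FiniteIndex]
    [hA : Group.FG A] : Group.FG G := by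
  obtain ⟨T, hT⟩ := (Group.fg_iff_subgroup_fg A).1 hA
  rw [Group.fg_iff]
  refine ⟨T ∪ Set.range (Quotient.out : G ⧸ A → G), ?_,
    T.finite_toSet.union (Set.finite_range (fun q : G ⧸ A => q.out))⟩
  rw [eq_top_iff]
  intro g _
  have hA' : A ≤ Subgroup.closure (T ∪ Set.range (Quotient.out : G ⧸ A → G)) := by
    conv_lhs => rw [← hT]
    exact Subgroup.closure_mono Set.subset_union_left
  have h1 : (Quotient.out (g : G ⧸ A))⁻¹ * g ∈ A := QuotientGroup.eq.1 (Quotient.out_eq' _)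
  have h2 : Quotient.out (g : G ⧸ A) ∈
      Subgroup.closure (T ∪ Set.range (Quotient.out : G ⧸ A → G)) :=
    Subgroup.subset_closure (Or.inr ⟨_, rfl⟩)
  have := mul_mem h2 (hA' h1)
  rwa [mul_inv_cancel_left] at this

section Bounds

variable {G : Type*} [Group G] {A : Subgroup G} {m : ℕ} (e : A ≃* Multiplicative (Fin m → ℤ))
  {S : Finset G}

include e in
theorem fg_of_equiv [A.FiniteIndex] : Group.FG G := by
  have h1 : AddGroup.FG (Fin m → ℤ) := Module.Finite.iff_addGroup_fg.1 inferInstance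
  have h2 : Group.FG (Multiplicative (Fin m → ℤ)) := AddGroup.fg_iff_mul_fg.1 h1
  have h3 : Group.FG A := Group.fg_of_surjective (f := e.symm.toMonoidHom) e.symm.surjective
  exact fg_of_finiteIndex A

variable [hN : A.Normal]

/-- If some automorphism takes `k(1+kt)` times a basis vector to `k(1+ks)` times it, where `k` is
the index of `A`, then `1+kt` divides `k(1+ks)`, hence `1+ks`, being prime to `k`. -/
theorem dvd_of_toOrbit_eq (i : Fin m) {s t : ℕ}
    (h : toOrbit (incl e ((A.index * (1 + A.index * s)) • Pi.single i 1) : G) =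
      toOrbit (incl e ((A.index * (1 + A.index * t)) • Pi.single i 1) : G)) :
    1 + A.index * t ∣ 1 + A.index * s := by
  obtain ⟨φ, hφ⟩ := toOrbit_eq_iff.1 h
  rw [mul_smul (A.index) (1 + A.index * t)] at hφ
  have h1 := congrFun (powMap_eq_of_apply_eq e hφ) i
  rw [map_nsmul] at h1
  simp only [Pi.smul_apply, Pi.single_eq_same, nsmul_eq_mul, mul_one] at h1
  have h2 : ((1 + A.index * t : ℕ) : ℤ) ∣ ((A.index * (1 + A.index * s) : ℕ) : ℤ) := ⟨_, h1.symm⟩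
  refine Nat.Coprime.dvd_of_dvd_mul_left ?_ (Int.natCast_dvd_natCast.1 h2)
  rw [Nat.coprime_add_mul_left_left]
  exact Nat.coprime_one_left _

variable [A.FiniteIndex]

/-- The transfer is Lipschitz with respect to the word length, because conjugation moves the
transfer of a letter through finitely many vectors only. -/
theorem exists_abs_transfer_le (hS : Subgroup.closure (S : Set G) = ⊤) :
    ∃ K : ℕ, ∀ g i, |transfer e g i| ≤ K * wordLength S g := by
  have : Finite (letters S) := finite_letters S
  obtain ⟨K, hK⟩ := Finite.exists_le (fun x : (G ⧸ A) × letters S × Fin m =>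
    (conjRep e x.1.out (transfer e (x.2.1 : G)) x.2.2).natAbs)
  refine ⟨K, fun g i => le_mul_wordLength (f := fun g => |transfer e g i|) hS ?_ ?_ g⟩
  · simp [transfer_one]
  · intro g u hu
    have h1 := hK ((g : G ⧸ A), ⟨u, hu⟩, i)
    simp only at h1
    rw [conjRep_congr e (QuotientGroup.out_eq' (g : G ⧸ A))] at h1
    have h2 : |conjRep e g (transfer e u) i| ≤ K := by
      rw [Int.abs_eq_natAbs]; exact_mod_cast h1
    simp only [transfer_mul, Pi.add_apply]
    exact (abs_add_le _ _).trans (by linarith)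

include e in
/-- `α_G` grows at most like the ball in `ℤ ^ m`. -/
theorem autGrowth_growthLE_pow (hS : Subgroup.closure (S : Set G) = ⊤) :
    GrowthLE (autGrowth S) (fun n => n ^ m) := by
  obtain ⟨K, hK⟩ := exists_abs_transfer_le e hS
  let := Fintype.ofFinite (G ⧸ A)
  refine GrowthLE.of_le_mul_pow (C := A.index * (2 * K + 1) ^ m) fun n => ?_
  refine (autGrowth_le_card (fun g : G => ((g : G ⧸ A), transfer e g))
    (Finset.univ ×ˢ Fintype.piFinset fun _ => Finset.Icc (-(K * n : ℤ)) (K * n)) n ?_ ?_).trans ?_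
  · intro g h hgh
    rw [eq_of_mk_eq_of_transfer_eq e (congrArg Prod.fst hgh) (congrArg Prod.snd hgh)]
  · intro g hg
    simp only [Finset.mem_product, Finset.mem_univ, true_and, Fintype.mem_piFinset,
      Finset.mem_Icc, ← abs_le]
    intro i
    refine (hK g i).trans ?_
    gcongr
  · rw [Finset.card_product, Fintype.card_piFinset, Finset.card_univ, Finset.prod_const,
      Int.card_Icc, Finset.card_univ, Fintype.card_fin, mul_assoc, ← mul_pow,
      Subgroup.index, Nat.card_eq_fintype_card]
    gcongr
    have : ((K * n : ℤ) + 1 - -(K * n)).toNat = 2 * (K * n) + 1 := by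
      have : (0 : ℤ) ≤ K * n := by positivity
      zify
      rw [Int.toNat_of_nonneg (by linarith)]
      ring
    rw [this]
    nlinarith [Nat.zero_le (K * n)]

include e in
/-- Multiples of a basis vector of `A` lie in linearly many automorphic orbits. -/
theorem growthLE_autGrowth_of_pos (hm : 0 < m) (hS : Subgroup.closure (S : Set G) = ⊤) :
    GrowthLE (fun n => n) (autGrowth S) := by
  set i : Fin m := ⟨0, hm⟩
  set k := A.index with hk
  set a : G := ((incl e (Pi.single i 1) : A) : G) with ha
  have hk0 : k ≠ 0 := Subgroup.FiniteIndex.index_ne_zero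
  refine GrowthLE.of_le_mul (autGrowth_mono hS) (L := 1) (C := k * (1 + k) * wordLength S a)
    fun n => ?_
  have hbound := card_le_mul_autGrowth hS (Finset.range n)
    (fun s => (incl e ((k * (1 + k * s)) • Pi.single i 1) : G))
    (k * (1 + k) * wordLength S a * (n + 1)) 1 ?_ ?_
  · simpa using hbound
  · intro s hs
    rw [incl_nsmul, Subgroup.coe_pow]
    refine (wordLength_pow_le hS _ _).trans ?_
    have : k * (1 + k * s) ≤ k * (1 + k) * (n + 1) := by
      have := Finset.mem_range.1 hs
      rw [mul_assoc]
      gcongr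
      nlinarith [Nat.mul_le_mul_left k this.le]
    calc k * (1 + k * s) * wordLength S a ≤ k * (1 + k) * (n + 1) * wordLength S a := by gcongr
      _ = _ := by ring
  · intro s _ t _ ht
    refine Finset.card_le_one.2 fun x hx y hy => ?_
    have h := (ht x hx).trans (ht y hy).symm
    have hxy := Nat.dvd_antisymm (dvd_of_toOrbit_eq e i h) (dvd_of_toOrbit_eq e i h.symm)
    have := Nat.add_left_cancel hxy
    exact (Nat.eq_of_mul_eq_mul_left (Nat.pos_of_ne_zero hk0) this).symm

end Bounds

/-! ### Integral 2 × 2 matrices -/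

section Matrices

open Matrix

/-- `P ^ n = U P - V` where `U`, `V` satisfy the recurrence of the characteristic polynomial. If
`|tr P| ≥ 2` then `|U|` is strictly increasing, so `P ^ n` can only be scalar if `P` is. -/
theorem exists_pow_eq_of_two_le_abs_trace {P : Matrix (Fin 2) (Fin 2) ℤ} (hdet : P.det = 1)
    (htr : 2 ≤ |P.trace|) (n : ℕ) :
    ∃ U V : ℤ, P ^ (n + 1) = U • P - V • (1 : Matrix (Fin 2) (Fin 2) ℤ) ∧ |V| < |U| := by
  induction n with
  | zero => exact ⟨1, 0, by simp, by simp⟩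
  | succ n ih =>
    obtain ⟨U, V, h, hUV⟩ := ih
    refine ⟨U * P.trace - V, U, ?_, ?_⟩
    · have hsq : P * P = P.trace • P - (1 : Matrix (Fin 2) (Fin 2) ℤ) := by
        rw [det_fin_two] at hdet
        ext i j
        fin_cases i <;> fin_cases j <;>
          simp [Matrix.mul_apply, Fin.sum_univ_two, trace_fin_two, -zsmul_eq_mul] <;> linarith
      rw [pow_succ, h, sub_mul, smul_mul_assoc, hsq, smul_mul_assoc, one_mul, smul_sub, smul_smul,
        sub_smul]
      abel
    · have h1 : |U * P.trace| ≤ |U * P.trace - V| + |V| := by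
        simpa using abs_add_le (U * P.trace - V) V
      rw [abs_mul] at h1
      nlinarith [abs_nonneg U, abs_nonneg V]

/-- A scalar matrix, given by its entries. -/
def IsScalarMat (P : Matrix (Fin 2) (Fin 2) ℤ) : Prop := P 0 1 = 0 ∧ P 1 0 = 0 ∧ P 0 0 = P 1 1

theorem isScalarMat_of_two_le_abs_trace {P : Matrix (Fin 2) (Fin 2) ℤ} (hdet : P.det = 1)
    (htr : 2 ≤ |P.trace|) {n : ℕ} (hn : n ≠ 0) (hP : P ^ n = 1) : IsScalarMat P := by
  obtain ⟨n, rfl⟩ := Nat.exists_eq_succ_of_ne_zero hn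
  obtain ⟨U, V, h, hUV⟩ := exists_pow_eq_of_two_le_abs_trace hdet htr n
  rw [Nat.succ_eq_add_one] at hP
  rw [hP] at h
  have hU : U ≠ 0 := by
    rintro rfl
    simp only [abs_zero] at hUV
    exact absurd hUV (abs_nonneg V).not_gt
  have h01 := congrFun (congrFun h 0) 1
  have h10 := congrFun (congrFun h 1) 0
  have h00 := congrFun (congrFun h 0) 0
  have h11 := congrFun (congrFun h 1) 1
  simp only [Matrix.sub_apply, Matrix.smul_apply, Matrix.one_apply, smul_eq_mul] at h01 h10 h00 h11
  simp at h01 h10 h00 h11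
  refine ⟨h01.resolve_left hU, h10.resolve_left hU, mul_left_cancel₀ hU ?_⟩
  linarith

/-- A nonscalar integral matrix of finite order is either elliptic or a reflection. -/
theorem elliptic_or_reflection {P : Matrix (Fin 2) (Fin 2) ℤ} {n : ℕ} (hn : n ≠ 0)
    (hP : P ^ n = 1) (hns : ¬ IsScalarMat P) :
    (P.det = 1 ∧ |P.trace| < 2) ∨ (P.det = -1 ∧ P.trace = 0) := by
  have hunit : IsUnit P.det := by
    have : P.det ^ n = 1 := by rw [← det_pow, hP, det_one]
    exact IsUnit.of_pow_eq_one this hn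
  rcases Int.isUnit_iff.1 hunit with hd | hd
  · refine Or.inl ⟨hd, ?_⟩
    by_contra h
    exact hns (isScalarMat_of_two_le_abs_trace hd (not_lt.1 h) hn hP)
  · refine Or.inr ⟨hd, ?_⟩
    -- The square of `P` has determinant one and trace `t² + 2`, so it is scalar: `tP + 1` is.
    have hsq : (P ^ 2).trace = P.trace ^ 2 + 2 := by
      rw [det_fin_two] at hd
      simp only [sq, trace_fin_two, Matrix.mul_apply, Fin.sum_univ_two]
      linarith
    have hs := isScalarMat_of_two_le_abs_trace (P := P ^ 2) (by rw [det_pow, hd]; norm_num)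
      (by rw [hsq, abs_of_nonneg (by positivity)]; nlinarith [sq_nonneg P.trace]) hn
      (by rw [← pow_mul, mul_comm, pow_mul, hP, one_pow])
    obtain ⟨h1, h2, h3⟩ := hs
    simp only [sq, Matrix.mul_apply, Fin.sum_univ_two] at h1 h2 h3
    rw [trace_fin_two]
    by_contra ht
    refine hns ⟨mul_right_cancel₀ ht ?_, mul_right_cancel₀ ht ?_, mul_right_cancel₀ ht ?_⟩ <;>
      linarith

/-- The discriminant of the characteristic polynomial. -/
def disc (P : Matrix (Fin 2) (Fin 2) ℤ) : ℤ := P.trace ^ 2 - 4 * P.det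

theorem disc_eq (P : Matrix (Fin 2) (Fin 2) ℤ) :
    disc P = (P 0 0 - P 1 1) ^ 2 + 4 * (P 0 1 * P 1 0) := by
  rw [disc, trace_fin_two, det_fin_two]
  ring

/-- The trace-free part of a matrix `S` commuting with a nonscalar `P` is a rational multiple
`x / u` of the trace-free part of `P`. -/
theorem exists_proportional {P S : Matrix (Fin 2) (Fin 2) ℤ} (hns : ¬ IsScalarMat P)
    (hc : S * P = P * S) : ∃ u x : ℤ, u ≠ 0 ∧ u * S 0 1 = x * P 0 1 ∧ u * S 1 0 = x * P 1 0 ∧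
      u * (S 0 0 - S 1 1) = x * (P 0 0 - P 1 1) := by
  have h00 := congrFun (congrFun hc 0) 0
  have h01 := congrFun (congrFun hc 0) 1
  have h10 := congrFun (congrFun hc 1) 0
  simp only [Matrix.mul_apply, Fin.sum_univ_two] at h00 h01 h10
  by_cases h1 : P 0 1 = 0
  · by_cases h2 : P 1 0 = 0
    · have h3 : P 0 0 - P 1 1 ≠ 0 := fun h => hns ⟨h1, h2, sub_eq_zero.1 h⟩
      exact ⟨_, S 0 0 - S 1 1, h3, by linarith, by linarith, by ring⟩
    · exact ⟨_, S 1 0, h2, by linarith, by ring, by linarith⟩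
  · exact ⟨_, S 0 1, h1, by ring, by linarith, by linarith⟩

/-- The traces of matrices commuting with a nonscalar matrix of finite order are bounded in terms
of the determinant: in the elliptic case they have non-positive discriminant, and in the case of a
reflection they have integral eigenvalues. -/
theorem abs_trace_le {P S : Matrix (Fin 2) (Fin 2) ℤ} {n : ℕ} (hn : n ≠ 0) (hP : P ^ n = 1)
    (hns : ¬ IsScalarMat P) (hc : S * P = P * S) (hS : S.det ≠ 0) :
    |S.trace| ≤ |S.det| + 1 := by
  obtain ⟨u, x, hu, h1, h2, h3⟩ := exists_proportional hns hc
  have hdisc : u ^ 2 * disc S = x ^ 2 * disc P := by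
    rw [disc_eq, disc_eq]
    linear_combination (u * (S 0 0 - S 1 1) + x * (P 0 0 - P 1 1)) * h3 +
      4 * u * S 1 0 * h1 + 4 * x * P 0 1 * h2
  have hu2 : 0 < u ^ 2 := by positivity
  rcases elliptic_or_reflection hn hP hns with ⟨hd, ht⟩ | ⟨hd, ht⟩
  · -- `S` has non-positive discriminant, so `t² ≤ 4 d ≤ (|d| + 1)²`.
    have hneg : disc P ≤ 0 := by
      rw [disc, hd, ← sq_abs]
      nlinarith [abs_nonneg P.trace]
    have hS0 : disc S ≤ 0 := by
      by_contra h
      have := mul_pos hu2 (not_le.1 h)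
      nlinarith [mul_nonneg (sq_nonneg x) (neg_nonneg.2 hneg)]
    rw [disc] at hS0
    refine abs_le_of_sq_le_sq ?_ (by positivity)
    nlinarith [le_abs_self S.det, sq_nonneg (|S.det| - 1)]
  · have hP4 : disc P = 2 ^ 2 := by rw [disc, hd, ht]; norm_num
    rw [hP4, ← mul_pow] at hdisc
    obtain ⟨s, hs⟩ : u ∣ x * 2 := (Int.pow_dvd_pow_iff two_ne_zero).1 ⟨_, hdisc.symm⟩
    have hs2 : disc S = s ^ 2 := by
      rw [hs, mul_pow] at hdisc
      exact mul_left_cancel₀ hu2.ne' hdisc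
    rw [disc] at hs2
    -- `(t - s) (t + s) = 4 d` with factors of the same parity.
    have heven : Even (S.trace - s) := by
      have : Even (S.trace ^ 2 - s ^ 2) := ⟨2 * S.det, by linarith⟩
      rw [Int.even_sub, Int.even_pow' two_ne_zero, Int.even_pow' two_ne_zero] at this
      exact Int.even_sub.2 this
    obtain ⟨p, hp⟩ := heven
    have htr : S.trace = p + (p + s) := by linarith
    have hpq : p * (p + s) = S.det := by rw [htr] at hs2; linarith
    have hp0 : p ≠ 0 := by rintro rfl; exact hS (by rw [← hpq, zero_mul])
    have hq0 : p + s ≠ 0 := by intro h; exact hS (by rw [← hpq, h, mul_zero])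
    rw [htr, ← hpq, abs_mul]
    have := abs_add_le p (p + s)
    nlinarith [Int.one_le_abs hp0, Int.one_le_abs hq0]

/-- A matrix `S` commuting with `P` is determined by the traces of `S` and `SP`. -/
theorem eq_of_trace_eq {P S S' : Matrix (Fin 2) (Fin 2) ℤ} {n : ℕ} (hn : n ≠ 0) (hP : P ^ n = 1)
    (hns : ¬ IsScalarMat P) (hc : S * P = P * S) (hc' : S' * P = P * S')
    (h1 : S.trace = S'.trace) (h2 : (S * P).trace = (S' * P).trace) : S = S' := by
  have hP0 : disc P ≠ 0 := by
    rcases elliptic_or_reflection hn hP hns with ⟨hd, ht⟩ | ⟨hd, ht⟩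
    · rw [disc, hd, ← sq_abs]
      nlinarith [abs_nonneg P.trace]
    · rw [disc, hd, ht]; norm_num
  rw [← sub_eq_zero]
  obtain ⟨u, x, hu, e1, e2, e3⟩ := exists_proportional (S := S - S') hns
    (by rw [sub_mul, mul_sub, hc, hc'])
  have t1 : (S - S').trace = 0 := by rw [trace_sub, h1, sub_self]
  have t2 : ((S - S') * P).trace = 0 := by rw [sub_mul, trace_sub, h2, sub_self]
  generalize S - S' = D at *
  rw [trace_fin_two] at t1 t2
  simp only [Matrix.mul_apply, Fin.sum_univ_two] at t2
  have hx : x * disc P = 0 := by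
    rw [disc_eq]
    linear_combination (-(P 0 0 - P 1 1)) * e3 - 2 * P 1 0 * e1 - 2 * P 0 1 * e2
      + 2 * u * t2 - u * (P 0 0 + P 1 1) * t1
  have hx0 : x = 0 := (mul_eq_zero.1 hx).resolve_right hP0
  subst hx0
  have d01 : D 0 1 = 0 := (mul_eq_zero.1 (e1.trans (zero_mul _))).resolve_left hu
  have d10 : D 1 0 = 0 := (mul_eq_zero.1 (e2.trans (zero_mul _))).resolve_left hu
  have d : D 0 0 - D 1 1 = 0 := (mul_eq_zero.1 (e3.trans (zero_mul _))).resolve_left hu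
  ext i j
  fin_cases i <;> fin_cases j <;> simp <;> omega

/-- A vector of `ℤ²` is an `SL₂(ℤ)`-translate of `(d, 0)`, where `d` is the gcd of its entries. -/
theorem exists_eq_mulVec (v : Fin 2 → ℤ) : ∃ (γ : Matrix (Fin 2) (Fin 2) ℤ) (d : ℕ),
    γ.det = 1 ∧ v = γ *ᵥ ![(d : ℤ), 0] ∧ (d : ℤ) ≤ |v 0| + |v 1| := by
  by_cases h : Int.gcd (v 0) (v 1) = 0
  · rw [Int.gcd_eq_zero_iff] at h
    refine ⟨1, 0, det_one, ?_, by simp [h.1, h.2]⟩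
    ext i
    fin_cases i <;> simp [h.1, h.2]
  · have hpos : 0 < Int.gcd (v 0) (v 1) := Nat.pos_of_ne_zero h
    obtain ⟨a, ha⟩ := Int.gcd_dvd_left (v 0) (v 1)
    obtain ⟨b, hb⟩ := Int.gcd_dvd_right (v 0) (v 1)
    have hbez := Int.gcd_eq_gcd_ab (v 0) (v 1)
    set d := Int.gcd (v 0) (v 1) with hd
    have hd0 : (d : ℤ) ≠ 0 := by exact_mod_cast h
    set x := Int.gcdA (v 0) (v 1)
    set y := Int.gcdB (v 0) (v 1)
    refine ⟨!![a, -y; b, x], d, ?_, ?_, ?_⟩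
    · rw [det_fin_two_of]
      apply mul_left_cancel₀ hd0
      linear_combination (-x) * ha - y * hb - hbez
    · ext i
      fin_cases i
      · simp [Matrix.mulVec, dotProduct, Fin.sum_univ_two]; linarith
      · simp [Matrix.mulVec, dotProduct, Fin.sum_univ_two]; linarith
    · have hd1 : (0 : ℤ) ≤ d := by positivity
      rcases eq_or_ne a 0 with ha0 | ha0
      · have hb0 : b ≠ 0 := by
          rintro rfl
          apply h
          rw [hd, ha, hb, ha0]; simp
        rw [hb, abs_mul, abs_of_nonneg hd1]
        nlinarith [Int.one_le_abs hb0, abs_nonneg (v 0)]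
      · rw [ha, abs_mul, abs_of_nonneg hd1]
        nlinarith [Int.one_le_abs ha0, abs_nonneg (v 1)]

end Matrices

open Matrix

/-! ### Scalar action on a rank two subgroup: linear growth -/

section Scalar

variable {G : Type*} [Group G] {A : Subgroup G} (e : A ≃* Multiplicative (Fin 2 → ℤ))
  [A.Normal] [A.FiniteIndex] {S : Finset G}

/-- If `G` acts on `A ≅ ℤ²` by scalars, then two elements `g`, `h` of one coset of `A` lie in the
same automorphic orbit as soon as `τ(g) = γw` and `τ(h) = δw` with `γ`, `δ` in `SL₂(ℤ)` congruent
modulo the index of `A`: the matrix `γδ⁻¹` is congruent to `1`, so it is induced by a shear. -/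
theorem toOrbit_eq_of_scalar (hsc : ∀ g, ∃ s : ℤ, ∀ v, conjRep e g v = s • v)
    {g h : G} (hgh : (g : G ⧸ A) = h) {γ δ : Matrix (Fin 2) (Fin 2) ℤ} (hγ : γ.det = 1)
    (hδ : δ.det = 1) {w : Fin 2 → ℤ} (hg : transfer e g = γ *ᵥ w) (hh : transfer e h = δ *ᵥ w)
    (hcongr : γ.map (Int.cast : ℤ → ZMod A.index) = δ.map Int.cast) : toOrbit g = toOrbit h := by
  have hdvd : ∀ i j, ∃ d, γ i j = δ i j + A.index * d := by
    intro i j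
    have h1 : ((γ i j : ℤ) : ZMod A.index) = δ i j := congrFun (congrFun hcongr i) j
    obtain ⟨d, hd⟩ := (ZMod.intCast_eq_intCast_iff_dvd_sub _ _ _).1 h1.symm
    exact ⟨d, by linarith⟩
  choose D hD using hdvd
  have hD' : γ = δ + A.index • of D := by
    ext i j
    simp [hD]
  have hcomm : ∀ (N : (Fin 2 → ℤ) →ₗ[ℤ] (Fin 2 → ℤ)) (g v),
      N (conjRep e g v) = conjRep e g (N v) := by
    intro N g v
    obtain ⟨s, hs⟩ := hsc g
    rw [hs, hs, map_smul]
  have hγa : γ * γ.adjugate = 1 := by rw [mul_adjugate, hγ, one_smul]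
  have hδa : δ * δ.adjugate = 1 := by rw [mul_adjugate, hδ, one_smul]
  have hγa' : γ.adjugate * γ = 1 := by rw [adjugate_mul, hγ, one_smul]
  have hδa' : δ.adjugate * δ = 1 := by rw [adjugate_mul, hδ, one_smul]
  have key1 : ∀ v, v + A.index • toLin' (of D * δ.adjugate) v = (γ * δ.adjugate) *ᵥ v := by
    intro v
    rw [hD', add_mul, hδa, add_mulVec, one_mulVec, toLin'_apply, smul_mul_assoc, smul_mulVec]
  have key2 : ∀ v, v + A.index • toLin' (-(of D * γ.adjugate)) v = (δ * γ.adjugate) *ᵥ v := by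
    intro v
    have : δ = γ - A.index • of D := by rw [hD', add_sub_cancel_right]
    rw [this, sub_mul, hγa, sub_mulVec, one_mulVec, toLin'_apply, smul_mul_assoc,
      smul_mulVec, neg_mulVec, smul_neg, sub_eq_add_neg]
  refine toOrbit_eq_of_transfer (hcomm (toLin' (of D * δ.adjugate)))
    (hcomm (toLin' (-(of D * γ.adjugate)))) ?_ ?_ hgh ?_
  · intro v
    rw [key2, key1, mulVec_mulVec, mul_assoc, ← mul_assoc _ γ, hγa', one_mul, hδa, one_mulVec]
  · intro v
    rw [key1, key2, mulVec_mulVec, mul_assoc, ← mul_assoc _ δ, hδa', one_mul, hγa, one_mulVec]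
  · rw [key1, hg, hh, mulVec_mulVec, mul_assoc, hδa', mul_one]

theorem autGrowth_growthLE_of_scalar (hsc : ∀ g, ∃ s : ℤ, ∀ v, conjRep e g v = s • v)
    (hS : Subgroup.closure (S : Set G) = ⊤) : GrowthLE (autGrowth S) (fun n => n) := by
  obtain ⟨K, hK⟩ := exists_abs_transfer_le e hS
  choose γ d hdet hv hd using exists_eq_mulVec
  have : NeZero A.index := ⟨Subgroup.FiniteIndex.index_ne_zero⟩
  let := Fintype.ofFinite (G ⧸ A)
  set Q := (Finset.univ : Finset ((G ⧸ A) × Matrix (Fin 2) (Fin 2) (ZMod A.index))) with hQ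
  have hbound : ∀ n, autGrowth S n ≤ (Q.card * (2 * K + 1)) * (n + 1) ^ 1 := by
    intro n
    refine (autGrowth_le_card
      (fun g : G => (((g : G ⧸ A), (γ (transfer e g)).map (Int.cast : ℤ → ZMod A.index)),
        d (transfer e g))) (Q ×ˢ Finset.range (2 * K * n + 1)) n ?_ ?_).trans ?_
    · intro g h hgh
      simp only [Prod.mk.injEq] at hgh
      obtain ⟨⟨h1, h2⟩, h3⟩ := hgh
      exact toOrbit_eq_of_scalar e hsc h1 (hdet _) (hdet _) (hv _) (h3 ▸ hv _) h2
    · intro g hg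
      simp only [Finset.mem_product, hQ, Finset.mem_univ, true_and, Finset.mem_range,
        Nat.lt_succ_iff]
      have h1 : ∀ i, |transfer e g i| ≤ K * n := fun i => (hK g i).trans (by gcongr)
      have := (hd (transfer e g)).trans (add_le_add (h1 0) (h1 1))
      zify
      linarith
    · rw [Finset.card_product, Finset.card_range, pow_one, mul_assoc Q.card]
      exact Nat.mul_le_mul_left _ (by nlinarith [Nat.zero_le (K * n)])
  simpa using GrowthLE.of_le_mul_pow hbound

end Scalar

/-! ### Nonscalar action on a rank two subgroup: quadratic growth -/

section Nonscalar

variable {G : Type*} [Group G] {A : Subgroup G} (e : A ≃* Multiplicative (Fin 2 → ℤ))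
  [A.Normal]

/-- The matrix of conjugation by `g`. -/
noncomputable def conjMat (g : G) : Matrix (Fin 2) (Fin 2) ℤ := LinearMap.toMatrix' (conjRep e g)

/-- The matrix of `powMap e φ`. -/
noncomputable def powMat (φ : MulAut G) : Matrix (Fin 2) (Fin 2) ℤ :=
  LinearMap.toMatrix' (powMap e φ)

theorem powMat_mulVec (φ : MulAut G) (v : Fin 2 → ℤ) : powMat e φ *ᵥ v = powMap e φ v :=
  LinearMap.toMatrix'_mulVec _ _

theorem powMat_mul_conjMat (φ : MulAut G) (g : G) :
    powMat e φ * conjMat e g = conjMat e (φ g) * powMat e φ := by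
  rw [powMat, conjMat, conjMat, ← LinearMap.toMatrix'_comp, ← LinearMap.toMatrix'_comp]
  congr 1
  exact LinearMap.ext fun v => powMap_conjRep e φ g v

theorem conjMat_pow_index (g : G) : conjMat e g ^ A.index = 1 := by
  have hpow : ∀ n, conjMat e g ^ n = conjMat e (g ^ n) := by
    intro n
    induction n with
    | zero =>
      have : conjRep e (g ^ 0) = LinearMap.id := LinearMap.ext fun v => by simp [conjRep_one]
      rw [conjMat, conjMat, this, LinearMap.toMatrix'_id, pow_zero]
    | succ n ih =>
      rw [pow_succ, pow_succ, ih, conjMat, conjMat, conjMat, ← LinearMap.toMatrix'_comp]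
      congr 1
      exact (LinearMap.ext fun v => conjRep_mul e (g ^ n) g v).symm
  rw [hpow, conjMat]
  have : conjRep e (g ^ A.index) = LinearMap.id :=
    LinearMap.ext fun v => conjRep_coe e ⟨_, A.pow_index_mem g⟩ v
  rw [this, LinearMap.toMatrix'_id]

theorem det_powMat_dvd (φ : MulAut G) : (powMat e φ).det ∣ (A.index : ℤ) ^ 4 := by
  have h : powMat e φ⁻¹ * powMat e φ =
      ((A.index : ℤ) * A.index) • (1 : Matrix (Fin 2) (Fin 2) ℤ) := by
    rw [powMat, powMat, ← LinearMap.toMatrix'_comp, ← LinearMap.toMatrix'_id, ← map_smul]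
    congr 1
    refine LinearMap.ext fun v => ?_
    rw [LinearMap.comp_apply, powMap_inv_powMap, ← natCast_zsmul]
    simp [mul_assoc]
  refine ⟨(powMat e φ⁻¹).det, ?_⟩
  have := congrArg Matrix.det h
  rw [det_mul, det_smul, det_one, Fintype.card_fin] at this
  linear_combination -this

theorem conjRep_eq_smul {g : G} (hg : IsScalarMat (conjMat e g)) (v : Fin 2 → ℤ) :
    conjRep e g v = conjMat e g 0 0 • v := by
  obtain ⟨h1, h2, h3⟩ := hg
  rw [← LinearMap.toMatrix'_mulVec (conjRep e g) v]
  change conjMat e g *ᵥ v = _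
  ext i
  fin_cases i <;> simp [mulVec, dotProduct, Fin.sum_univ_two, h1, h2, h3]

variable [A.FiniteIndex]

theorem det_powMat_ne_zero (φ : MulAut G) : (powMat e φ).det ≠ 0 := by
  intro h
  have h1 := det_powMat_dvd e φ
  rw [h, zero_dvd_iff] at h1
  have : (A.index : ℤ) ≠ 0 := by exact_mod_cast Subgroup.FiniteIndex.index_ne_zero
  exact pow_ne_zero 4 this h1

theorem abs_det_powMat_le (φ : MulAut G) : |(powMat e φ).det| ≤ (A.index : ℤ) ^ 4 := by
  have h0 : (A.index : ℤ) ≠ 0 := by exact_mod_cast Subgroup.FiniteIndex.index_ne_zero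
  exact Int.le_of_dvd (by positivity) ((abs_dvd _ _).2 (det_powMat_dvd e φ))

/-- If `φ` and `ψ` map `g` to the same coset, then `adj(T_φ) T_ψ` commutes with conjugation
by `g`, where `T_φ = powMat e φ`: both `T_φ` and `T_ψ` intertwine the conjugations by `g` and by
`φ(g)`. -/
theorem adjugate_powMat_mul_comm {φ ψ : MulAut G} {g : G} (h : (φ g : G ⧸ A) = ψ g) :
    ((powMat e φ).adjugate * powMat e ψ) * conjMat e g =
      conjMat e g * ((powMat e φ).adjugate * powMat e ψ) := by
  have h1 : (powMat e φ).adjugate * conjMat e (φ g) = conjMat e g * (powMat e φ).adjugate := by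
    have h2 : (powMat e φ).adjugate * (powMat e φ * conjMat e g) * (powMat e φ).adjugate =
        (powMat e φ).adjugate * (conjMat e (φ g) * powMat e φ) * (powMat e φ).adjugate := by
      rw [powMat_mul_conjMat]
    rw [← mul_assoc, adjugate_mul, mul_assoc _ (_ * _), mul_assoc (conjMat e (φ g)),
      mul_adjugate, smul_mul_assoc, smul_mul_assoc, one_mul, mul_smul_comm, mul_one,
      mul_smul_comm] at h2
    exact (smul_right_injective _ (det_powMat_ne_zero e φ) h2).symm
  have h3 : conjMat e (φ g) = conjMat e (ψ g) := by rw [conjMat, conjMat, conjRep_congr e h]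
  rw [mul_assoc, powMat_mul_conjMat, ← h3, ← mul_assoc, h1, mul_assoc]

/-- Each automorphic orbit contains boundedly many elements of `A ^ k`, where `k` is the index of
`A`: up to finitely many choices, automorphisms act on `A ^ k` through matrices of bounded
determinant in the commutant of a nonscalar matrix of finite order, of which there are
finitely many. -/
theorem exists_card_orbit_le {g : G} (hg : ¬ IsScalarMat (conjMat e g)) :
    ∃ L : ℕ, ∀ (v : Fin 2 → ℤ) (t : Finset (Fin 2 → ℤ)),
      (∀ w ∈ t, toOrbit (incl e (A.index • w) : G) = toOrbit (incl e (A.index • v) : G)) →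
        t.card ≤ L := by
  classical
  let := Fintype.ofFinite (G ⧸ A)
  have hk : A.index ≠ 0 := Subgroup.FiniteIndex.index_ne_zero
  set B : ℤ := (A.index : ℤ) ^ 4 * (A.index : ℤ) ^ 4 + 1 with hB
  set P := conjMat e g with hPdef
  have hP : P ^ A.index = 1 := conjMat_pow_index e g
  -- One reference automorphism for each coset that occurs.
  have hbase : ∀ q : G ⧸ A, ∃ φ : MulAut G, ∀ ψ : MulAut G, (ψ g : G ⧸ A) = q →
      (φ g : G ⧸ A) = q := by
    intro q
    by_cases h : ∃ φ : MulAut G, (φ g : G ⧸ A) = q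
    · exact ⟨h.choose, fun _ _ => h.choose_spec⟩
    · exact ⟨1, fun ψ hψ => (h ⟨ψ, hψ⟩).elim⟩
  choose base hbase using hbase
  refine ⟨((Finset.univ : Finset (G ⧸ A)) ×ˢ Finset.Icc (-B) B ×ˢ Finset.Icc (-B) B).card,
    fun v t ht => ?_⟩
  choose! φ hφ using fun w hw => toOrbit_eq_iff.1 (ht w hw)
  set M : (Fin 2 → ℤ) → Matrix (Fin 2) (Fin 2) ℤ :=
    fun w => (powMat e (base (φ w g : G ⧸ A))).adjugate * powMat e (φ w) with hM
  have hcomm : ∀ w, M w * P = P * M w := fun w =>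
    adjugate_powMat_mul_comm e (hbase _ (φ w) rfl)
  have hdet : ∀ w, (M w).det ≠ 0 ∧ |(M w).det| + 1 ≤ B := by
    intro w
    have h2 : (M w).det = (powMat e (base (φ w g : G ⧸ A))).det * (powMat e (φ w)).det := by
      rw [hM, det_mul, det_adjugate, Fintype.card_fin, pow_one]
    rw [h2]
    refine ⟨mul_ne_zero (det_powMat_ne_zero e _) (det_powMat_ne_zero e _), ?_⟩
    rw [abs_mul, hB]
    gcongr
    · exact abs_det_powMat_le e _
    · exact abs_det_powMat_le e _
  have hdetP : |P.det| = 1 := by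
    rcases elliptic_or_reflection hk hP hg with ⟨h, _⟩ | ⟨h, _⟩ <;> rw [h] <;> norm_num
  have hP0 : P.det ≠ 0 := by
    intro h
    rw [h] at hdetP
    norm_num at hdetP
  refine Finset.card_le_card_of_injOn
    (fun w => ((φ w g : G ⧸ A), (M w).trace, (M w * P).trace)) ?_ ?_
  · intro w _
    simp only [Finset.coe_product, Set.mem_prod, Finset.mem_coe, Finset.mem_univ, true_and,
      Finset.mem_Icc, ← abs_le]
    refine ⟨(abs_trace_le hk hP hg (hcomm w) (hdet w).1).trans (hdet w).2, ?_⟩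
    refine (abs_trace_le hk hP hg (by rw [hcomm w, mul_assoc, hcomm w]) ?_).trans
      (le_trans (le_of_eq ?_) (hdet w).2)
    · rw [det_mul]; exact mul_ne_zero (hdet w).1 hP0
    · rw [det_mul, abs_mul, hdetP, mul_one]
  · intro w hw w' hw' h
    simp only [Prod.mk.injEq] at h
    obtain ⟨h1, h2, h3⟩ := h
    have hMM : M w = M w' := eq_of_trace_eq hk hP hg (hcomm w) (hcomm w') h2 h3
    simp only [hM, ← h1] at hMM
    have h4 := congrArg (powMat e (base (φ w g : G ⧸ A)) * ·) hMM
    simp only [← mul_assoc, mul_adjugate, smul_mul_assoc, one_mul] at h4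
    have h5 : powMat e (φ w) = powMat e (φ w') :=
      smul_right_injective _ (det_powMat_ne_zero e _) h4
    have h6 : A.index • w = A.index • w' := by
      rw [← powMap_eq_of_apply_eq e (hφ w hw), ← powMap_eq_of_apply_eq e (hφ w' hw'),
        ← powMat_mulVec, ← powMat_mulVec, h5]
    exact nsmul_right_injective hk h6

theorem sq_growthLE_autGrowth {g : G} (hg : ¬ IsScalarMat (conjMat e g)) {S : Finset G}
    (hS : Subgroup.closure (S : Set G) = ⊤) : GrowthLE (fun n => n ^ 2) (autGrowth S) := by
  obtain ⟨L, hL⟩ := exists_card_orbit_le e hg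
  set a : G := ((incl e (A.index • Pi.single 0 1) : A) : G) with ha
  set b : G := ((incl e (A.index • Pi.single 1 1) : A) : G) with hb
  refine GrowthLE.of_le_mul (autGrowth_mono hS) (L := L)
    (C := wordLength S a + wordLength S b) fun n => ?_
  set f : ℕ × ℕ → (Fin 2 → ℤ) := fun p => ![(p.1 : ℤ), p.2] with hf
  have hfinj : Function.Injective f := by
    intro p q h
    have h0 := congrFun h 0
    have h1 := congrFun h 1
    simp only [hf, cons_val_zero, cons_val_one, Nat.cast_inj] at h0 h1
    exact Prod.ext h0 h1
  have hbound := card_le_mul_autGrowth hS (Finset.range n ×ˢ Finset.range n)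
    (fun p => (incl e (A.index • f p) : G)) ((wordLength S a + wordLength S b) * (n + 1)) L ?_ ?_
  · simpa [sq] using hbound
  · intro p hp
    obtain ⟨hp1, hp2⟩ := Finset.mem_product.1 hp
    have hp1' := (Finset.mem_range.1 hp1).le
    have hp2' := (Finset.mem_range.1 hp2).le
    have hprod : (incl e (A.index • f p) : G) = a ^ p.1 * b ^ p.2 := by
      rw [ha, hb, ← Subgroup.coe_pow, ← Subgroup.coe_pow, ← Subgroup.coe_mul, ← incl_nsmul,
        ← incl_nsmul, ← incl_add]
      congr 2
      ext i
      fin_cases i <;> simp [hf, mul_comm]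
    rw [hprod]
    refine (wordLength_mul_le hS _ _).trans ((add_le_add (wordLength_pow_le hS a p.1)
      (wordLength_pow_le hS b p.2)).trans ?_)
    nlinarith [Nat.mul_le_mul_right (wordLength S a) hp1',
      Nat.mul_le_mul_right (wordLength S b) hp2']
  · intro p _ t _ ht
    rw [← Finset.card_image_of_injective t hfinj]
    refine hL (f p) _ fun w hw => ?_
    obtain ⟨q, hq, rfl⟩ := Finset.mem_image.1 hw
    exact ht q hq

end Nonscalar

/-! ### The sign homomorphism -/

section Sign

variable {G : Type*} [Group G] {A : Subgroup G} {m : ℕ} (e : A ≃* Multiplicative (Fin m → ℤ))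
  [A.Normal]

include e in
/-- If `G` acts on `A ≅ ℤ ^ m`, `m > 0`, by scalars, the scalars form a homomorphism to the units
of `ℤ`. -/
theorem exists_sgn_of_scalar (hm : 0 < m) (hsc : ∀ g, ∃ s : ℤ, ∀ v, conjRep e g v = s • v) :
    ∃ sgn : G →* ℤˣ, ∀ g : G, ∀ x ∈ A, g⁻¹ * x * g = x ^ ((sgn g : ℤˣ) : ℤ) := by
  choose s hs using hsc
  have hval : ∀ g, s g = conjRep e g (Pi.single ⟨0, hm⟩ 1) ⟨0, hm⟩ := fun g => by simp [hs]
  let σ : G →* ℤ :=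
    { toFun := s
      map_one' := by rw [hval, conjRep_one, Pi.single_eq_same]
      map_mul' := fun g h => by rw [hval, conjRep_mul, hs, hs]; simp }
  refine ⟨σ.toHomUnits, fun g x hx => ?_⟩
  have h1 : (((σ.toHomUnits g : ℤˣ)) : ℤ) = s g⁻¹ := by
    have : σ.toHomUnits g = σ.toHomUnits g⁻¹ := by rw [map_inv, Int.units_inv_eq_self]
    rw [this]
    rfl
  have h2 : MulAut.conjNormal g⁻¹ (⟨x, hx⟩ : A) = (⟨x, hx⟩ : A) ^ s g⁻¹ := by
    apply coord_injective e
    rw [coord_zpow, ← conjRep_coord, hs]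
  have h3 := congrArg (Subtype.val) h2
  rw [MulAut.conjNormal_apply, inv_inv, Subgroup.coe_zpow] at h3
  rw [h1, ← h3]

theorem conjRep_eq_smul_of_sgn {sgn : G →* ℤˣ}
    (hsgn : ∀ g : G, ∀ x ∈ A, g⁻¹ * x * g = x ^ ((sgn g : ℤˣ) : ℤ)) (g : G) (v : Fin m → ℤ) :
    conjRep e g v = ((sgn g⁻¹ : ℤˣ) : ℤ) • v := by
  have h1 : MulAut.conjNormal g (incl e v) = incl e v ^ ((sgn g⁻¹ : ℤˣ) : ℤ) := by
    apply Subtype.ext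
    have := hsgn g⁻¹ (incl e v) (incl e v).2
    rw [inv_inv] at this
    rw [MulAut.conjNormal_apply, this, Subgroup.coe_zpow]
  have h2 := congrArg (coord e) h1
  rwa [← conjRep_coord, coord_zpow, coord_incl] at h2

end Sign

end AutGrowth

open AutGrowth

/-! ### Automorphic growth in ranks zero, one and two -/

theorem mainTheorem4 {G : Type*} [Group G] (A : Subgroup G) [A.Normal] [A.FiniteIndex]
    (m : ℕ) (hA : Nonempty (A ≃* Multiplicative (Fin m → ℤ))) :
    (m = 0 → AutGrowth.HasConstantAutGrowth G) ∧
    (m = 1 → AutGrowth.HasLinearAutGrowth G) ∧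
    (m = 2 →
      (AutGrowth.HasLinearAutGrowth G ∨ AutGrowth.HasQuadraticAutGrowth G) ∧
      (AutGrowth.HasLinearAutGrowth G ↔
        ∃ sgn : G →* ℤˣ, ∀ g : G, ∀ x ∈ A, g⁻¹ * x * g = x ^ ((sgn g : ℤˣ) : ℤ))) := by
  obtain ⟨e⟩ := hA
  have hfg : Group.FG G := fg_of_equiv e
  refine ⟨?_, ?_, ?_⟩
  · rintro rfl
    refine ⟨hfg, fun S hS => ⟨by simpa using autGrowth_growthLE_pow e hS, 1, one_ne_zero, ?_⟩⟩
    exact fun n => Nat.le_add_left _ _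
  · rintro rfl
    exact ⟨hfg, fun S hS => ⟨by simpa using autGrowth_growthLE_pow e hS,
      growthLE_autGrowth_of_pos e one_pos hS⟩⟩
  · rintro rfl
    by_cases hsc : ∀ g, IsScalarMat (conjMat e g)
    · have hsc' : ∀ g, ∃ s : ℤ, ∀ v, conjRep e g v = s • v :=
        fun g => ⟨_, conjRep_eq_smul e (hsc g)⟩
      have hlin : HasLinearAutGrowth G := ⟨hfg, fun S hS =>
        ⟨autGrowth_growthLE_of_scalar e hsc' hS, growthLE_autGrowth_of_pos e two_pos hS⟩⟩
      exact ⟨Or.inl hlin, fun _ => exists_sgn_of_scalar e two_pos hsc', fun _ => hlin⟩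
    · obtain ⟨g, hg⟩ := not_forall.1 hsc
      refine ⟨Or.inr ⟨hfg, fun S hS =>
        ⟨autGrowth_growthLE_pow e hS, sq_growthLE_autGrowth e hg hS⟩⟩, fun hlin => ?_, ?_⟩
      · obtain ⟨S, hS⟩ := Group.fg_def.1 hfg
        have h1 := (hlin.2 S hS).1
        exact absurd ((sq_growthLE_autGrowth e hg hS).trans monotone_id h1) not_growthLE_sq_id
      · rintro ⟨sgn, hsgn⟩
        refine absurd ?_ hg
        have h := conjRep_eq_smul_of_sgn e hsgn g
        refine ⟨?_, ?_, ?_⟩ <;> simp [conjMat, LinearMap.toMatrix'_apply, h]
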